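/- Let $T,x_0,k_0,\sigma,c_1>0$, let $\phi\in(0,1]$, let $A=[a_{\min},a_{\max}]$ be a compact interval with $0\in A$, and let $h:[0,T]\times\mathbb R\to\mathbb R$ and $l:\mathbb R\to\mathbb R$ be Borel measurable with $|h(t,x)|+|l(x)|\le c_1e^{c_1|x|}$ for all $(t,x)\in[0,T]\times\mathbb R$. Let $W$ be a Wiener process on $[0,T]$ with respect to a filtration $\mathbb F=(\mathcal F_t)_{0\le t\le T}$ on a probability space $(\Omega,\mathcal F,\mathbb P)$, and let $\xi$ be an $\mathcal F_0$-measurable random variable with law $\lambda_0$ satisfying $\int e^{p|x|}\,\lambda_0(dx)<\infty$ for every $p>0$. Put $\psi(x)=e^{c_1|x|}$ for $x\in\mathbb R$ and $\psi(x)=e^{c_1\|x\|_\infty}$ for $x\in C([0,T];\mathbb R)$. Let $\mathcal P_\psi(\mathbb R)$ be the set of probability measures $\mu$ on $\mathbb R$ with $\int\psi\,d\mu<\infty$, with the weakest topology making $\mu\mapsto\int F\,d\mu$ continuous for every measurable $F:\mathbb R\to\mathbb R$ with $\sup_x|F(x)|/\psi(x)<\infty$. A flow is a measurable map $q:[0,T]\to\mathcal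 P(A)$, $t\mapsto q_t$; write $\bar q_t=\int_A\tilde a\,dq_t(\tilde a)$ and $Q_t=\int_0^t\bar q_s\,ds$. The pool reserve along $q$ is $x_0-Q_t$. For $t\in[0,T]$, $x\in\mathbb R$, $\mu\in\mathcal P_\psi(\mathbb R)$, a flow $q$ and $a\in A$ set $b(t,x,\mu,a)=a$, $g(x,\mu)=l(x)$ and $$f(t,x,\mu,q,a)=x\,k_0\,\bar q_t\,\frac{(1+\phi)x_0-2\phi Q_t}{(x_0-Q_t)^2(x_0-\phi Q_t)^2}+a\Big(1-\frac{1+\phi^2}{2\phi}\Big)\frac{k_0}{(x_0-Q_t)^2(x_0-\phi Q_t)^2}-h(t,x).$$ Then: (S.1) $A$ is a compact convex subset of $\mathbb R$, and $b:[0,T]\times\mathbb R\times\mathcal P_\psi(\mathbb R)\times A\to\mathbb R$ is continuous. (S.2) There is a strong solution $X$ (with values in $C([0,T];\mathbb R)$) of $dX_t=\sigma\,dW_t$, $X_0=\xi$, with $\mathbb E[\psi^2(X)]<\infty$; moreover $\sigma>0$ and $\sigma^{-1}b$ is uniformly bounded. For every $\varepsilon_0>0$, (S.3) and (S.4) below hold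 with $\mathcal Q$ the set of flows whose pool reserve satisfies $x_0-Q_t\ge\varepsilon_0$ for all $t\in[0,T]$: (S.3) for each $\mu$, each $q\in\mathcal Q$ and each $a$, the map $(t,x)\mapsto f(t,x,\mu,q,a)$ is Borel measurable on $[0,T]\times\mathbb R$, and $(t,x)\mapsto f(t,x_t,\mu,q,a)$ is progressively measurable on $[0,T]\times C([0,T];\mathbb R)$ for the canonical filtration; $a\mapsto f(t,x,\mu,q,a)$ is continuous on $A$ for all $t,x,\mu$ and $q\in\mathcal Q$; and $x\mapsto g(x,\mu)$ is Borel measurable for each $\mu$. (S.4) There is $c>0$ with $|g(x,\mu)|+|f(t,x,\mu,q,a)|\le c\,\psi(x)$ for all $t,x,\mu,a$ and all $q\in\mathcal Q$. Likewise there is $C>0$ with $|g(x,\mu)|+|f(t,x,\mu,q,a)|\le Ce^{C|x|}$ for all these arguments. Finally, if $|a|\le M$ for all $a\in A$ and $M<x_0/T$, then there is $\varepsilon_0>0$ such that $x_0-Q_t>\varepsilon_0$ and $x_0-\phi Q_t>\varepsilon_0$ for all flows $q$ and all $t\in[0,T]$, and (S.3) and (S.4) hold with $\mathcal Q$ the set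 of all flows. -/

import Mathlib

open MeasureTheory ProbabilityTheory

noncomputable section

namespace FeePool

/-- The time interval `[0,T]`. -/
abbrev Time (T : ℝ) : Type := Set.Icc (0 : ℝ) T

/-- The path space `C([0,T]; ℝ)`; its norm is the supremum norm. -/
abbrev Path (T : ℝ) : Type := C(Time T, ℝ)

/-! ### Measures integrating a weight -/

/-- `B_ψ(ℝ)`: measurable functions `F` with `sup |F| / ψ < ∞` (for a weight `ψ > 0`). -/
def WeightBounded (ψ : ℝ → ℝ) : Set (ℝ → ℝ) :=
  {F | Measurable F ∧ ∃ C : ℝ, ∀ x, |F x| ≤ C * ψ x}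

/-- `P_ψ(ℝ)`: the probability measures `μ` on `ℝ` with `∫ ψ dμ < ∞`. -/
def WeightedProb (ψ : ℝ → ℝ) : Type :=
  {μ : ProbabilityMeasure ℝ // Integrable ψ (μ : Measure ℝ)}

/-- The weakest topology on `P_ψ(ℝ)` that makes `μ ↦ ∫ F dμ` continuous for every
`F ∈ B_ψ(ℝ)`. -/
instance (ψ : ℝ → ℝ) : TopologicalSpace (WeightedProb ψ) :=
  ⨅ F : WeightBounded ψ,
    TopologicalSpace.induced
      (fun μ : WeightedProb ψ => ∫ x, F.1 x ∂(μ.1 : Measure ℝ)) inferInstance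

/-! ### The data of the model -/

/-- Data and standing assumptions of the fee-adjusted trader game: horizon `T`, initial pool
reserve `x₀`, initial invariant `k₀`, fee parameter `φ = 1 - τ`, volatility `σ`, control interval
`[aMin, aMax]` containing the origin, running cost `h`, terminal cost `l`. -/
structure Model where
  T : ℝ
  T_pos : 0 < T
  x₀ : ℝ
  x₀_pos : 0 < x₀
  k₀ : ℝ
  k₀_pos : 0 < k₀
  φ : ℝ
  φ_pos : 0 < φ
  φ_le_one : φ ≤ 1
  σ : ℝ
  σ_pos : 0 < σ
  aMin : ℝ
  aMax : ℝ
  aMin_le : aMin ≤ 0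
  le_aMax : 0 ≤ aMax
  h : Time T → ℝ → ℝ
  h_meas : Measurable (fun p : Time T × ℝ => h p.1 p.2)
  l : ℝ → ℝ
  l_meas : Measurable l
  c₁ : ℝ
  c₁_pos : 0 < c₁
  cost_bound : ∀ t x, |h t x| + |l x| ≤ c₁ * Real.exp (c₁ * |x|)

namespace Model

variable (m : Model)

/-- The control space `A`. -/
def A : Set ℝ := Set.Icc m.aMin m.aMax

/-- The weight `ψ(x) = exp (c₁ |x|)` on the state space. -/
def ψ (x : ℝ) : ℝ := Real.exp (m.c₁ * |x|)

/-- The weight `ψ(x) = exp (c₁ ‖x‖)` on the path space, `‖·‖` being the supremum norm. On constant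
paths it is the weight on the state space. -/
def ψPath (x : Path m.T) : ℝ := Real.exp (m.c₁ * ‖x‖)

/-- Measurable flows `(q_t)_{0 ≤ t ≤ T}` of probability measures on the control space. -/
def Flow : Type := {q : Time m.T → ProbabilityMeasure m.A // Measurable q}

variable {m}

/-- The mean control `∫_A ã dq_t(ã)`. -/
def meanControl (q : m.Flow) (t : Time m.T) : ℝ := ∫ a : m.A, (a : ℝ) ∂(q.1 t : Measure m.A)

/-- The aggregate amount `∫_0^t ∫_A ã dq_s(ã) ds`. -/
def traded (q : m.Flow) (t : Time m.T) : ℝ := 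
  ∫ s in Set.Iic t, meanControl q s ∂(Measure.comap (Subtype.val : Time m.T → ℝ) volume)

/-- The pool reserve `X_0 - ∫_0^t ∫_A ã dq_s(ã) ds`. -/
def reserve (q : m.Flow) (t : Time m.T) : ℝ := m.x₀ - traded q t

/-- The fee-adjusted reserve `X_0 - φ ∫_0^t ∫_A ã dq_s(ã) ds`. -/
def feeReserve (q : m.Flow) (t : Time m.T) : ℝ := m.x₀ - m.φ * traded q t

variable (m)

/-- The flows along which the pool reserve stays at or above `ε₀` on the whole of `[0,T]`. -/
def flowsAbove (ε₀ : ℝ) : Set m.Flow := {q | ∀ t, ε₀ ≤ reserve q t}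

/-- The drift. -/
def b (_t : Time m.T) (_x : ℝ) (_μ : WeightedProb m.ψ) (a : m.A) : ℝ := a

/-- The terminal cost function. -/
def g (x : ℝ) (_μ : WeightedProb m.ψ) : ℝ := m.l x

/-- The price-impact coefficient. -/
def Γ (t : Time m.T) (_x : ℝ) (_μ : WeightedProb m.ψ) (q : m.Flow) (_a : m.A) : ℝ :=
  m.k₀ * meanControl q t *
    (((1 + m.φ) * m.x₀ - 2 * m.φ * traded q t) / (reserve q t ^ 2 * feeReserve q t ^ 2))

/-- The transaction-cost term. -/
def Λ (t : Time m.T) (_x : ℝ) (_μ : WeightedProb m.ψ) (q : m.Flow) (a : m.A) : ℝ :=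
  (a : ℝ) * (1 - (1 + m.φ ^ 2) / (2 * m.φ)) *
    (m.k₀ / (reserve q t ^ 2 * feeReserve q t ^ 2))

/-- The running reward. It depends on the flow `q` up to time `t`, not only on `q_t`. -/
def f (t : Time m.T) (x : ℝ) (μ : WeightedProb m.ψ) (q : m.Flow) (a : m.A) : ℝ :=
  x * m.Γ t x μ q a + m.Λ t x μ q a - m.h t x

end Model

/-! ### Stochastic basis -/

/-- `W` is a Wiener process on `[0,T]` with respect to the filtration `𝓕`. -/
structure IsWiener {Ω : Type*} {mΩ : MeasurableSpace Ω} {T : ℝ} (𝓕 : Filtration (Time T) mΩ)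
    (P : Measure Ω) (W : Ω → Path T) : Prop where
  adapted : ∀ t, Measurable[𝓕 t] (fun ω => W ω t)
  zero : ∀ t : Time T, (t : ℝ) = 0 → ∀ᵐ ω ∂P, W ω t = 0
  indep : ∀ s t : Time T, s ≤ t →
    Indep (MeasurableSpace.comap (fun ω => W ω t - W ω s) inferInstance) (𝓕 s) P
  law : ∀ s t : Time T, s ≤ t →
    P.map (fun ω => W ω t - W ω s) = gaussianReal 0 (Real.toNNReal ((t : ℝ) - s))

/-- The σ-algebra generated by `ξ` and by `W_s`, `s ≤ t`, augmented by the null sets. -/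
@[reducible] def augmentedHistory {Ω : Type*} {mΩ : MeasurableSpace Ω} {T : ℝ} (P : Measure Ω)
    (ξ : Ω → ℝ) (W : Ω → Path T) (t : Time T) : MeasurableSpace Ω :=
  eventuallyMeasurableSpace
    (MeasurableSpace.comap ξ inferInstance ⊔
      ⨆ s : Set.Iic t, MeasurableSpace.comap (fun ω => W ω s) inferInstance)
    (ae P)

/-- `X` is a strong solution on `[0,T]` of `dX_t = σ dW_t`, `X_0 = ξ`: it is continuous, adapted to
`𝓕` and to the augmented history of `(ξ, W)`, and almost surely `X_t = ξ + ∫_0^t σ dW_s` for all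
`t`; the integrand being constant, the Itô integral is `σ (W_t - W_0)`, with `W_0 = 0`. -/
structure IsStrongDriftlessSolution {Ω : Type*} {mΩ : MeasurableSpace Ω} {T : ℝ}
    (𝓕 : Filtration (Time T) mΩ) (P : Measure Ω) (σ : ℝ) (ξ : Ω → ℝ) (W X : Ω → Path T) :
    Prop where
  adapted : ∀ t, Measurable[𝓕 t] (fun ω => X ω t)
  strong : ∀ t, Measurable[augmentedHistory P ξ W t] (fun ω => X ω t)
  initial : ∀ t : Time T, (t : ℝ) = 0 → ∀ᵐ ω ∂P, X ω t = ξ ω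
  equation : ∀ᵐ ω ∂P, ∀ t, X ω t = ξ ω + σ * W ω t

/-- The σ-algebra on path space generated by the coordinates. -/
@[reducible] def pathSigma (T : ℝ) : MeasurableSpace (Path T) :=
  ⨆ s : Time T, MeasurableSpace.comap (fun x : Path T => x s) inferInstance

/-- The canonical filtration on path space. -/
def pathFiltration (T : ℝ) : Filtration (Time T) (pathSigma T) where
  seq t := ⨆ s : Set.Iic t, MeasurableSpace.comap (fun x : Path T => x s) inferInstance
  mono' _ t hst := iSup_le fun r => le_iSup
    (fun u : Set.Iic t => MeasurableSpace.comap (fun x : Path T => x u) inferInstance)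
    ⟨r.1, le_trans r.2 hst⟩
  le' _ := iSup_le fun r => le_iSup
    (fun s : Time T => MeasurableSpace.comap (fun x : Path T => x s) inferInstance) r.1

/-! ### The hypotheses of the existence theorem -/

/-- (S.1): compact convex control space, continuous drift. -/
structure HypS1 (m : Model) : Prop where
  compact : IsCompact m.A
  convex : Convex ℝ m.A
  drift : Continuous
    (fun p : Time m.T × ℝ × WeightedProb m.ψ × m.A => m.b p.1 p.2.1 p.2.2.1 p.2.2.2)

/-- (S.2): a strong solution of the driftless equation with `E[ψ²(X)] < ∞`; positive volatility;
`σ⁻¹ b` uniformly bounded. -/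
structure HypS2 {Ω : Type*} {mΩ : MeasurableSpace Ω} (m : Model) (𝓕 : Filtration (Time m.T) mΩ)
    (P : Measure Ω) (ξ : Ω → ℝ) (W : Ω → Path m.T) : Prop where
  solution : ∃ X : Ω → Path m.T, IsStrongDriftlessSolution 𝓕 P m.σ ξ W X ∧
    Integrable (fun ω => m.ψPath (X ω) ^ 2) P
  volatility : 0 < m.σ
  drift_bounded : ∃ K : ℝ, ∀ t x μ a, |m.σ⁻¹ * m.b t x μ a| ≤ K

/-- (S.3) over the flows `q ∈ Q`. Progressive measurability is expressed both as joint Borel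
measurability on `[0,T] × ℝ` and as progressive measurability, for the canonical filtration of
`C([0,T]; ℝ)`, of the functional `(t, x) ↦ f(t, x_t, μ, q, a)`. -/
structure HypS3 (m : Model) (Q : Set m.Flow) : Prop where
  borel : ∀ μ, ∀ q ∈ Q, ∀ a, Measurable (fun p : Time m.T × ℝ => m.f p.1 p.2 μ q a)
  progressive : ∀ μ, ∀ q ∈ Q, ∀ a,
    IsStronglyProgressive (pathFiltration m.T) (fun t x => m.f t (x t) μ q a)
  continuous : ∀ t x μ, ∀ q ∈ Q, Continuous (fun a => m.f t x μ q a)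
  terminal : ∀ μ, Measurable (fun x => m.g x μ)

/-- (S.4) over the flows `q ∈ Q`: growth at most `c ψ`, and hence at most `C exp (C |x|)`. -/
structure HypS4 (m : Model) (Q : Set m.Flow) : Prop where
  weight_bound : ∃ c > 0, ∀ t x μ, ∀ q ∈ Q, ∀ a,
    |m.g x μ| + |m.f t x μ q a| ≤ c * m.ψ x
  exp_bound : ∃ C > 0, ∀ t x μ, ∀ q ∈ Q, ∀ a,
    |m.g x μ| + |m.f t x μ q a| ≤ C * Real.exp (C * |x|)

end FeePool

end

/-! The analytic content lies in (S.2) and (S.4); (S.1) and (S.3) are continuity and measurability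
checks. For (S.2) the solution is `X = ξ + σ W`. Cauchy's inequality separates `ξ` from `W` without
using their independence, so it suffices that `‖W‖` has all exponential moments
(`integrable_exp_norm`). Doob's maximal inequality for a submartingale dominating `exp (2p|W|)`
gives `exp (p max |W|)` a tail `O(ε⁻²)` on every finite grid, with a constant independent of the
grid; Fatou's lemma passes to the supremum. For (S.4), a lower bound on the reserve also bounds the
fee-adjusted reserve below (`feeReserve_ge`), so `Γ` and `Λ` are bounded, and the factor `x` is
absorbed by `ψ`. When `M T < x₀`, the bound `|Q_t| ≤ M T` supplies this lower bound for every flow.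
-/

noncomputable section

namespace FeePool

/-! ### Measurability and bounds of the coefficients -/

namespace Model

variable {m : Model}

lemma measurable_meanControl (q : m.Flow) : Measurable (meanControl q) := by
  let κ : Kernel (Time m.T) m.A :=
    ⟨fun t => (q.1 t : Measure m.A), measurable_subtype_coe.comp q.2⟩
  have h : StronglyMeasurable (fun a : m.A => (a : ℝ)) :=
    measurable_subtype_coe.stronglyMeasurable
  exact (h.integral_kernel (κ := κ)).measurable

lemma abs_meanControl_le {M : ℝ} (hM : ∀ a ∈ m.A, |a| ≤ M) (q : m.Flow) (t : Time m.T) :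
    |meanControl q t| ≤ M := by
  have h := norm_integral_le_of_norm_le_const (μ := (q.1 t : Measure m.A))
    (f := fun a : m.A => (a : ℝ)) (C := M) (ae_of_all _ fun a => hM a a.2)
  simpa [meanControl] using h

lemma volume_time_univ (m : Model) :
    Measure.comap (Subtype.val : Time m.T → ℝ) volume Set.univ = ENNReal.ofReal m.T := by
  rw [comap_subtype_coe_apply measurableSet_Icc, Set.image_univ, Subtype.range_coe,
    Real.volume_Icc, sub_zero]

/-- The moving domain of integration becomes an indicator, jointly measurable in `(t, s)`, and
Fubini applies. -/
lemma measurable_traded (q : m.Flow) : Measurable (traded q) := by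
  have : IsFiniteMeasure (Measure.comap (Subtype.val : Time m.T → ℝ) volume) :=
    ⟨by rw [volume_time_univ]; exact ENNReal.ofReal_lt_top⟩
  have hm : Measurable (Function.uncurry fun t s : Time m.T =>
      (Set.Iic t).indicator (meanControl q) s) := by
    have : (Function.uncurry fun t s : Time m.T => (Set.Iic t).indicator (meanControl q) s)
        = {p : Time m.T × Time m.T | p.2 ≤ p.1}.indicator (fun p => meanControl q p.2) := by
      ext p
      simp [Function.uncurry, Set.indicator_apply]
    rw [this]
    exact ((measurable_meanControl q).comp measurable_snd).indicator
      (measurableSet_le measurable_snd measurable_fst)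
  have h := (hm.stronglyMeasurable.integral_prod_right
    (ν := Measure.comap (Subtype.val : Time m.T → ℝ) volume)).measurable
  convert h using 1
  ext t
  exact (integral_indicator measurableSet_Iic).symm

lemma abs_traded_le {M : ℝ} (hM : ∀ a ∈ m.A, |a| ≤ M) (q : m.Flow) (t : Time m.T) :
    |traded q t| ≤ M * m.T := by
  have hM0 : 0 ≤ M := (abs_nonneg _).trans (abs_meanControl_le hM q t)
  have hle : Measure.comap (Subtype.val : Time m.T → ℝ) volume (Set.Iic t)
      ≤ ENNReal.ofReal m.T :=
    (measure_mono (Set.subset_univ _)).trans (volume_time_univ m).le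
  have h := norm_setIntegral_le_of_norm_le_const
    (μ := Measure.comap (Subtype.val : Time m.T → ℝ) volume) (s := Set.Iic t)
    (f := meanControl q) (hle.trans_lt ENNReal.ofReal_lt_top)
    (fun s _ => abs_meanControl_le hM q s)
  refine h.trans (mul_le_mul_of_nonneg_left ?_ hM0)
  exact ENNReal.toReal_le_of_le_ofReal m.T_pos.le hle

/-- If the traded amount is nonnegative, `φ ≤ 1` makes the fee-adjusted reserve at least the
reserve; if it is nonpositive, `φ > 0` makes it at least `x₀`. -/
lemma feeReserve_ge {ε : ℝ} {q : m.Flow} {t : Time m.T} (h : ε ≤ reserve q t) :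
    min ε m.x₀ ≤ feeReserve q t := by
  unfold reserve at h
  unfold feeReserve
  have hφ := m.φ_pos
  have hφ1 := m.φ_le_one
  rcases le_total 0 (traded q t) with h0 | h0
  · exact (min_le_left _ _).trans (by nlinarith)
  · exact (min_le_right _ _).trans (by nlinarith)

/-- A bound for the absolute value of every control. -/
def controlBound (m : Model) : ℝ := max (-m.aMin) m.aMax

lemma abs_le_controlBound (m : Model) : ∀ a ∈ m.A, |a| ≤ m.controlBound := by
  intro a ha
  rw [abs_le, controlBound]
  exact ⟨by linarith [ha.1, le_max_left (-m.aMin) m.aMax], ha.2.trans (le_max_right _ _)⟩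

lemma controlBound_nonneg (m : Model) : 0 ≤ m.controlBound := m.le_aMax.trans (le_max_right _ _)

lemma exists_bound_coefficients (m : Model) {ε : ℝ} (hε : 0 < ε) :
    ∃ K, 0 ≤ K ∧ ∀ t x μ, ∀ q ∈ m.flowsAbove ε, ∀ a,
      |m.Γ t x μ q a| ≤ K ∧ |m.Λ t x μ q a| ≤ K := by
  have hφ := m.φ_pos
  have hk := m.k₀_pos
  have hx := m.x₀_pos
  have hT := m.T_pos
  have hM := m.controlBound_nonneg
  set M := m.controlBound
  set δ := ε ^ 2 * (min ε m.x₀) ^ 2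
  have hmin : 0 < min ε m.x₀ := lt_min hε hx
  have hδ0 : 0 < δ := by positivity
  set N := (1 + m.φ) * m.x₀ + 2 * m.φ * (M * m.T) with hN
  have hN0 : 0 ≤ N := by positivity
  refine ⟨max (m.k₀ * M * (N / δ)) (M * |1 - (1 + m.φ ^ 2) / (2 * m.φ)| * (m.k₀ / δ)),
    le_max_of_le_left (by positivity), fun t x μ q hq a => ?_⟩
  have hden : δ ≤ reserve q t ^ 2 * feeReserve q t ^ 2 :=
    mul_le_mul (pow_le_pow_left₀ hε.le (hq t) 2)
      (pow_le_pow_left₀ hmin.le (feeReserve_ge (hq t)) 2) (by positivity) (by positivity)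
  have hmean := abs_meanControl_le m.abs_le_controlBound q t
  have htr := abs_traded_le m.abs_le_controlBound q t
  have hnum : |(1 + m.φ) * m.x₀ - 2 * m.φ * traded q t| ≤ N := by
    refine (abs_sub _ _).trans ?_
    rw [abs_of_pos (by positivity : 0 < (1 + m.φ) * m.x₀), abs_mul,
      abs_of_pos (by positivity : 0 < 2 * m.φ), hN]
    gcongr
  have hd0 : 0 < reserve q t ^ 2 * feeReserve q t ^ 2 := hδ0.trans_le hden
  constructor
  · refine le_max_of_le_left ?_
    rw [Γ, abs_mul, abs_mul, abs_div, abs_of_pos hk, abs_of_pos hd0]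
    gcongr
  · refine le_max_of_le_right ?_
    rw [Λ, abs_mul, abs_mul, abs_div, abs_of_pos hk, abs_of_pos hd0]
    gcongr
    exact m.abs_le_controlBound a a.2

lemma measurable_f (μ : WeightedProb m.ψ) (q : m.Flow) (a : m.A) :
    Measurable (fun p : Time m.T × ℝ => m.f p.1 p.2 μ q a) := by
  have h1 : Measurable fun p : Time m.T × ℝ => meanControl q p.1 :=
    (measurable_meanControl q).comp measurable_fst
  have h2 : Measurable fun p : Time m.T × ℝ => traded q p.1 :=
    (measurable_traded q).comp measurable_fst
  have h3 := m.h_meas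
  unfold f Γ Λ reserve feeReserve
  fun_prop

end Model

/-! ### Hypotheses (S.1), (S.3), (S.4) and the reserve bound -/

lemma measurable_apply_pathFiltration {T : ℝ} {s t : Time T} (h : s ≤ t) :
    Measurable[pathFiltration T t] (fun x : Path T => x s) :=
  Measurable.of_comap_le (le_iSup
    (fun s : Set.Iic t => MeasurableSpace.comap (fun x : Path T => x s) inferInstance) ⟨s, h⟩)

lemma isStronglyProgressive_apply (T : ℝ) :
    IsStronglyProgressive (pathFiltration T) (fun t (x : Path T) => x t) :=
  StronglyAdapted.isStronglyProgressive_of_continuous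
    (fun _ => (measurable_apply_pathFiltration (le_refl _)).stronglyMeasurable)
    (fun x => x.continuous)

lemma hypS1 (m : Model) : HypS1 m where
  compact := isCompact_Icc
  convex := convex_Icc _ _
  drift := continuous_subtype_val.comp continuous_snd.snd.snd

/-- No lower bound on the reserve enters: division by zero returns zero, which preserves
measurability, and `f` is affine in `a`. Progressivity follows by composing with the continuous
adapted coordinate process. -/
lemma hypS3 (m : Model) (Q : Set m.Flow) : HypS3 m Q where
  borel μ q _ a := m.measurable_f μ q a
  progressive μ q _ a t := by
    have h := (isStronglyProgressive_apply m.T t).measurable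
    refine Measurable.stronglyMeasurable ?_
    exact (m.measurable_f μ q a).comp
      ((measurable_subtype_coe.comp measurable_fst).prodMk h)
  continuous t x μ q _ := by
    unfold Model.f Model.Γ Model.Λ
    fun_prop
  terminal _ := m.l_meas

lemma hypS4 (m : Model) {ε : ℝ} (hε : 0 < ε) : HypS4 m (m.flowsAbove ε) := by
  obtain ⟨K, hK, hb⟩ := m.exists_bound_coefficients hε
  have hc₁ := m.c₁_pos
  have key : ∀ t x μ, ∀ q ∈ m.flowsAbove ε, ∀ a,
      |m.g x μ| + |m.f t x μ q a| ≤ (K / m.c₁ + K + m.c₁) * m.ψ x := by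
    intro t x μ q hq a
    obtain ⟨h1, h2⟩ := hb t x μ q hq a
    -- From `1 + u ≤ exp u` at `u = c₁|x|`; hence the term `K / c₁` in the constant.
    have hx : |x| * m.c₁ + 1 ≤ m.ψ x := by
      rw [mul_comm]
      exact Real.add_one_le_exp _
    have hx0 : |x| ≤ m.ψ x / m.c₁ := by
      rw [le_div_iff₀ hc₁]
      linarith
    have hψ1 : 1 ≤ m.ψ x := Real.one_le_exp (by positivity)
    have h3 : |m.h t x| + |m.l x| ≤ m.c₁ * m.ψ x := m.cost_bound t x
    have hxΓ : |x * m.Γ t x μ q a| ≤ K / m.c₁ * m.ψ x := by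
      rw [abs_mul]
      calc |x| * |m.Γ t x μ q a| ≤ m.ψ x / m.c₁ * K := by gcongr
        _ = K / m.c₁ * m.ψ x := by ring
    have hΛ : |m.Λ t x μ q a| ≤ K * m.ψ x := h2.trans (le_mul_of_one_le_right hK hψ1)
    have hf : |m.f t x μ q a| ≤ |x * m.Γ t x μ q a| + |m.Λ t x μ q a| + |m.h t x| :=
      (abs_sub _ _).trans (by gcongr; exact abs_add_le _ _)
    calc |m.g x μ| + |m.f t x μ q a|
        ≤ |m.l x| + (|x * m.Γ t x μ q a| + |m.Λ t x μ q a| + |m.h t x|) := by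
          exact add_le_add (le_refl |m.l x|) hf
      _ ≤ _ := by linarith
  have hc : 0 < K / m.c₁ + K + m.c₁ := by positivity
  -- The same constant serves in the exponent because it is at least `c₁`.
  refine ⟨⟨_, hc, key⟩, _, hc, fun t x μ q hq a => (key t x μ q hq a).trans ?_⟩
  unfold Model.ψ
  gcongr
  have : 0 ≤ K / m.c₁ := by positivity
  linarith

lemma exists_reserve_bound (m : Model) {M : ℝ} (hM : ∀ a ∈ m.A, |a| ≤ M)
    (hlt : M < m.x₀ / m.T) :
    ∃ ε₀ : ℝ, 0 < ε₀ ∧ ∀ (q : m.Flow) (t : Time m.T),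
      ε₀ < Model.reserve q t ∧ ε₀ < Model.feeReserve q t := by
  have hM0 : 0 ≤ M := (abs_nonneg _).trans (hM 0 ⟨m.aMin_le, m.le_aMax⟩)
  have hMT : M * m.T < m.x₀ := (lt_div_iff₀ m.T_pos).1 hlt
  have hMT0 : 0 ≤ M * m.T := mul_nonneg hM0 m.T_pos.le
  -- Halving the gap makes both inequalities strict.
  refine ⟨(m.x₀ - M * m.T) / 2, by linarith, fun q t => ?_⟩
  have ht := (abs_le.1 (Model.abs_traded_le hM q t)).2
  have hr : m.x₀ - M * m.T ≤ Model.reserve q t := by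
    unfold Model.reserve
    linarith
  refine ⟨by linarith, lt_of_lt_of_le ?_ (Model.feeReserve_ge hr)⟩
  exact lt_min (by linarith) (by linarith)

/-! ### Exponential moments of the running maximum -/

lemma measurable_norm_path {Ω : Type*} {mΩ : MeasurableSpace Ω} {T : ℝ} (hT : 0 ≤ T)
    {W : Ω → Path T} (hW : ∀ t, Measurable fun ω => W ω t) : Measurable fun ω => ‖W ω‖ := by
  have : Nonempty (Time T) := ⟨⟨0, le_rfl, hT⟩⟩
  refine measurable_of_Iic fun c => ?_
  have : (fun ω => ‖W ω‖) ⁻¹' Set.Iic c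
      = ⋂ n, {ω | ‖W ω (TopologicalSpace.denseSeq (Time T) n)‖ ≤ c} := by
    ext ω
    simp only [Set.mem_preimage, Set.mem_Iic, Set.mem_iInter, Set.mem_ofPred_eq]
    refine ⟨fun h n => ((W ω).norm_coe_le_norm _).trans h, fun h => ?_⟩
    rw [ContinuousMap.norm_le_of_nonempty]
    have hcl : IsClosed {t | ‖W ω t‖ ≤ c} := isClosed_le (W ω).continuous.norm continuous_const
    intro t
    exact hcl.closure_subset_iff.2 (Set.range_subset_iff.2 h)
      (TopologicalSpace.denseRange_denseSeq (Time T) t)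
  rw [this]
  exact MeasurableSet.iInter fun n => measurableSet_le (hW _).norm measurable_const

/-- A nonnegative random variable with tails `O(ε⁻²)` is integrable. -/
lemma lintegral_le_of_sq_mul_measure_le {Ω : Type*} {mΩ : MeasurableSpace Ω} {P : Measure Ω}
    [IsProbabilityMeasure P] {X : Ω → ℝ} (hX : Measurable X) (hX0 : 0 ≤ X) {C : ENNReal}
    (h : ∀ ε : ℝ, 0 < ε → ENNReal.ofReal (ε ^ 2) * P {ω | ε ≤ X ω} ≤ C) :
    ∫⁻ ω, ENNReal.ofReal (X ω) ∂P ≤ 1 + C := by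
  -- Layer cake, split at `1`: the tail is at most `1` below and at most `C t⁻²` above.
  rw [lintegral_eq_lintegral_meas_le P (ae_of_all _ hX0) hX.aemeasurable,
    ← Set.Ioc_union_Ioi_eq_Ioi zero_le_one]
  refine (lintegral_union_le _ _ _).trans (add_le_add ?_ ?_)
  · calc ∫⁻ t in Set.Ioc (0 : ℝ) 1, P {ω | t ≤ X ω} ≤ ∫⁻ _ in Set.Ioc (0 : ℝ) 1, 1 :=
          lintegral_mono fun _ => prob_le_one
      _ = 1 := by simp
  · calc ∫⁻ t in Set.Ioi (1 : ℝ), P {ω | t ≤ X ω}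
        ≤ ∫⁻ t in Set.Ioi (1 : ℝ), ENNReal.ofReal (t ^ (-2 : ℝ)) * C := by
          refine setLIntegral_mono' measurableSet_Ioi fun t ht => ?_
          have ht0 : 0 < t := zero_lt_one.trans ht
          have hinv : ENNReal.ofReal (t ^ (-2 : ℝ)) * ENNReal.ofReal (t ^ 2) = 1 := by
            rw [← ENNReal.ofReal_mul (by positivity), Real.rpow_neg ht0.le, Real.rpow_two,
              inv_mul_cancel₀ (by positivity), ENNReal.ofReal_one]
          calc P {ω | t ≤ X ω}
              = ENNReal.ofReal (t ^ (-2 : ℝ)) *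
                  (ENNReal.ofReal (t ^ 2) * P {ω | t ≤ X ω}) := by
                rw [← mul_assoc, hinv, one_mul]
            _ ≤ _ := by gcongr; exact h t ht0
      _ = C := by
          rw [lintegral_mul_const _ (by fun_prop), ← ofReal_integral_eq_lintegral_ofReal
            (integrableOn_Ioi_rpow_of_lt (by norm_num) zero_lt_one)
            ((ae_restrict_iff' measurableSet_Ioi).2 (ae_of_all _ fun t ht =>
              Real.rpow_nonneg (zero_le_one.trans (le_of_lt ht)) _)),
            integral_Ioi_rpow_of_lt (by norm_num) zero_lt_one]
          norm_num

namespace IsWiener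

variable {Ω : Type*} {mΩ : MeasurableSpace Ω} {T : ℝ} {𝓕 : Filtration (Time T) mΩ}
  {P : Measure Ω} {W : Ω → Path T}

lemma measurable (hW : IsWiener 𝓕 P W) (t : Time T) : Measurable fun ω => W ω t :=
  (hW.adapted t).mono (𝓕.le t) le_rfl

lemma integrable_exp_increment (hW : IsWiener 𝓕 P W) {s t : Time T} (hst : s ≤ t) (θ : ℝ) :
    Integrable (fun ω => Real.exp (θ * (W ω t - W ω s))) P := by
  have hm : Measurable fun ω => W ω t - W ω s := (hW.measurable t).sub (hW.measurable s)
  have h := integrable_exp_mul_gaussianReal (μ := 0) (v := Real.toNNReal ((t : ℝ) - s)) θ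
  rw [← hW.law s t hst] at h
  exact h.comp_measurable hm

lemma integral_exp_increment (hW : IsWiener 𝓕 P W) {s t : Time T} (hst : s ≤ t) (θ : ℝ) :
    ∫ ω, Real.exp (θ * (W ω t - W ω s)) ∂P = Real.exp (((t : ℝ) - s) * θ ^ 2 / 2) := by
  have h := mgf_gaussianReal (hW.law s t hst) θ
  rw [mgf, Real.coe_toNNReal _ (sub_nonneg.2 hst), zero_mul, zero_add] at h
  exact h

lemma increment_zero_ae_eq (hW : IsWiener 𝓕 P W) (hT : 0 ≤ T) (t : Time T) :
    (fun ω => W ω t - W ω ⟨0, le_rfl, hT⟩) =ᵐ[P] fun ω => W ω t := by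
  filter_upwards [hW.zero ⟨0, le_rfl, hT⟩ rfl] with ω h
  rw [h, sub_zero]

lemma integrable_exp (hW : IsWiener 𝓕 P W) (t : Time T) (θ : ℝ) :
    Integrable (fun ω => Real.exp (θ * W ω t)) P := by
  have hT : 0 ≤ T := t.2.1.trans t.2.2
  refine (hW.integrable_exp_increment (s := ⟨0, le_rfl, hT⟩) (t := t) t.2.1 θ).congr ?_
  filter_upwards [hW.increment_zero_ae_eq hT t] with ω h
  rw [h]

lemma integral_exp (hW : IsWiener 𝓕 P W) (t : Time T) (θ : ℝ) :
    ∫ ω, Real.exp (θ * W ω t) ∂P = Real.exp ((t : ℝ) * θ ^ 2 / 2) := by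
  have hT : 0 ≤ T := t.2.1.trans t.2.2
  rw [← sub_zero (t : ℝ), ← hW.integral_exp_increment (s := ⟨0, le_rfl, hT⟩) (t := t) t.2.1 θ]
  refine integral_congr_ae ?_
  filter_upwards [hW.increment_zero_ae_eq hT t] with ω h
  rw [h]

/-- The exponential of the increment is independent of the past and has mean `exp ((t - s) θ² / 2) ≥
1`. -/
lemma submartingale_exp [IsProbabilityMeasure P] (hW : IsWiener 𝓕 P W) (θ : ℝ) :
    Submartingale (fun t ω => Real.exp (θ * W ω t)) 𝓕 P := by
  have hadp : ∀ t, StronglyMeasurable[𝓕 t] fun ω => Real.exp (θ * W ω t) := fun t =>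
    (((hW.adapted t).const_mul θ).exp).stronglyMeasurable
  refine ⟨hadp, fun s t hst => ?_, fun t => hW.integrable_exp t θ⟩
  have hmul : (fun ω => Real.exp (θ * W ω t)) =
      (fun ω => Real.exp (θ * W ω s)) * fun ω => Real.exp (θ * (W ω t - W ω s)) := by
    ext ω
    rw [Pi.mul_apply, ← Real.exp_add]
    ring_nf
  have hpull := condExp_mul_of_stronglyMeasurable_left (μ := P) (hadp s)
    (hmul ▸ hW.integrable_exp t θ) (hW.integrable_exp_increment hst θ)
  have hm : Measurable fun ω => W ω t - W ω s := (hW.measurable t).sub (hW.measurable s)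
  have hind := condExp_indep_eq (μ := P) hm.comap_le (𝓕.le s)
    (f := fun ω => Real.exp (θ * (W ω t - W ω s)))
    (((comap_measurable _).const_mul θ).exp).stronglyMeasurable (hW.indep s t hst)
  rw [← hmul] at hpull
  filter_upwards [hpull, hind] with ω h1 h2
  rw [h1, Pi.mul_apply, h2, hW.integral_exp_increment hst]
  refine le_mul_of_one_le_right (Real.exp_pos _).le (Real.one_le_exp ?_)
  have : (0 : ℝ) ≤ t - s := sub_nonneg.2 hst
  positivity

/-- Doob's inequality for the exponential of a Wiener process along finitely many times. -/
lemma lintegral_exp_abs_sup'_le [IsProbabilityMeasure P] (hW : IsWiener 𝓕 P W) (p : ℝ)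
    {τ : ℕ → Time T} (hτ : Monotone τ) (n : ℕ) :
    ∫⁻ ω, ENNReal.ofReal ((Finset.range (n + 1)).sup' Finset.nonempty_range_add_one
      fun k => Real.exp (p * |W ω (τ k)|)) ∂P
      ≤ 1 + ENNReal.ofReal (2 * Real.exp (T * (2 * p) ^ 2 / 2)) := by
  let 𝓖 : Filtration ℕ mΩ :=
    ⟨fun k => 𝓕 (τ k), fun i j hij => 𝓕.mono (hτ hij), fun k => 𝓕.le _⟩
  -- The two signs together dominate `exp (2p|W|)`, the square of the target; Doob at level `ε²`
  -- then yields the `ε⁻²` tail.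
  let M : ℕ → Ω → ℝ := fun k ω =>
    Real.exp (2 * p * W ω (τ k)) + Real.exp (-(2 * p) * W ω (τ k))
  have hM : Submartingale M 𝓖 P := by
    have h := (hW.submartingale_exp (2 * p)).add (hW.submartingale_exp (-(2 * p)))
    exact ⟨fun k => h.1 (τ k), fun i j hij => h.2.1 _ _ (hτ hij), fun k => h.2.2 (τ k)⟩
  have hM0 : 0 ≤ M := fun k ω => by positivity
  have hMint : ∫ ω, M n ω ∂P ≤ 2 * Real.exp (T * (2 * p) ^ 2 / 2) := by
    rw [integral_add (hW.integrable_exp _ _) (hW.integrable_exp _ _), hW.integral_exp,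
      hW.integral_exp, neg_sq, ← two_mul]
    have := (τ n).2.2
    gcongr
  have hle : ∀ k ω, Real.exp (p * |W ω (τ k)|) ^ 2 ≤ M k ω := by
    intro k ω
    rw [← Real.exp_nat_mul]
    rcases abs_choice (W ω (τ k)) with h | h <;> rw [h]
    · refine le_of_eq_of_le ?_ (le_add_of_nonneg_right (Real.exp_pos _).le)
      push_cast
      ring_nf
    · refine le_of_eq_of_le ?_ (le_add_of_nonneg_left (Real.exp_pos _).le)
      push_cast
      ring_nf
  refine lintegral_le_of_sq_mul_measure_le ?_ ?_ fun ε hε => ?_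
  · exact Finset.measurable_range_sup'' fun k _ => ((hW.measurable _).norm.const_mul p).exp
  · intro ω
    exact (Real.exp_pos _).le.trans (Finset.le_sup' (fun k => Real.exp (p * |W ω (τ k)|))
      (Finset.mem_range.2 n.succ_pos))
  · refine le_trans ?_ ((maximal_ineq hM hM0 (ε := Real.toNNReal (ε ^ 2)) n).trans
      (ENNReal.ofReal_le_ofReal ?_))
    · refine mul_le_mul' le_rfl (measure_mono fun ω hω => ?_)
      obtain ⟨k, hk, hεk⟩ := (Finset.le_sup'_iff _).1 (Set.mem_ofPred.1 hω)
      refine Set.mem_ofPred.2 ((Finset.le_sup'_iff _).2 ⟨k, hk, ?_⟩)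
      rw [Real.coe_toNNReal _ (sq_nonneg _)]
      exact (pow_le_pow_left₀ hε.le hεk 2).trans (hle k ω)
    · exact (setIntegral_le_integral (hM.integrable n) (ae_of_all _ (hM0 n))).trans hMint

/-- Exponential moments of the running maximum of a Wiener process. -/
lemma integrable_exp_norm [IsProbabilityMeasure P] (hW : IsWiener 𝓕 P W) (hT : 0 < T) (p : ℝ) :
    Integrable (fun ω => Real.exp (p * ‖W ω‖)) P := by
  have : Nonempty (Time T) := ⟨⟨0, le_rfl, hT.le⟩⟩
  let τ : ℕ → ℕ → Time T := fun n k => Set.projIcc 0 T hT.le (k * (T / n))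
  have hτ : ∀ n, Monotone (τ n) := fun n i j hij => Set.monotone_projIcc hT.le (by gcongr)
  let F : ℕ → Ω → ENNReal := fun n ω => ENNReal.ofReal ((Finset.range (n + 1)).sup'
    Finset.nonempty_range_add_one fun k => Real.exp (p * |W ω (τ n k)|))
  have hF : ∀ n, Measurable (F n) := fun n => (Finset.measurable_range_sup'' fun k _ =>
    ((hW.measurable _).norm.const_mul p).exp).ennreal_ofReal
  have hlim : ∀ ω, ENNReal.ofReal (Real.exp (p * ‖W ω‖))
      ≤ Filter.liminf (fun n => F n ω) Filter.atTop := by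
    intro ω
    obtain ⟨t, ht⟩ : ∃ t, ‖W ω t‖ = ‖W ω‖ := by
      obtain ⟨t, -, ht⟩ := isCompact_univ.exists_isMaxOn Set.univ_nonempty
        (W ω).continuous.norm.continuousOn
      exact ⟨t, ((W ω).norm_coe_le_norm t).antisymm
        ((W ω).norm_le_of_nonempty.2 fun s => ht (Set.mem_univ s))⟩
    -- The grid point `k n * T / n` tends to the maximiser `t`, so the grid maxima have liminf at
    -- least the true value.
    let k : ℕ → ℕ := fun n => ⌊t / T * (n : ℝ)⌋₊
    have htt : Filter.Tendsto (fun n => τ n (k n)) Filter.atTop (nhds t) := by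
      have h1 := ((tendsto_nat_floor_mul_div_atTop (div_nonneg t.2.1 hT.le)).comp
        (tendsto_natCast_atTop_atTop (R := ℝ))).mul_const T
      rw [div_mul_cancel₀ _ hT.ne'] at h1
      have h2 := ((continuous_projIcc (h := hT.le)).tendsto (t : ℝ)).comp h1
      rw [Set.projIcc_val] at h2
      refine h2.congr fun n => ?_
      simp only [Function.comp_apply, τ, k]
      congr 1
      ring
    have hk : ∀ n, k n ≤ n := by
      intro n
      refine Nat.floor_le_of_le (mul_le_of_le_one_left n.cast_nonneg ?_)
      exact div_le_one_of_le₀ t.2.2 hT.le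
    have hcont : Filter.Tendsto (fun n => ENNReal.ofReal (Real.exp (p * |W ω (τ n (k n))|)))
        Filter.atTop (nhds (ENNReal.ofReal (Real.exp (p * ‖W ω‖)))) := by
      rw [← ht]
      refine ENNReal.tendsto_ofReal ((Real.continuous_exp.tendsto _).comp ?_)
      exact ((((W ω).continuous.tendsto t).comp htt).norm).const_mul p
    rw [← hcont.liminf_eq]
    refine Filter.liminf_le_liminf (Filter.Eventually.of_forall fun n => ?_)
    exact ENNReal.ofReal_le_ofReal (Finset.le_sup' (fun k => Real.exp (p * |W ω (τ n k)|))
      (Finset.mem_range.2 (Nat.lt_succ_of_le (hk n))))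
  have hbound : ∫⁻ ω, ENNReal.ofReal (Real.exp (p * ‖W ω‖)) ∂P
      ≤ 1 + ENNReal.ofReal (2 * Real.exp (T * (2 * p) ^ 2 / 2)) := by
    refine (lintegral_mono hlim).trans ((lintegral_liminf_le hF).trans ?_)
    refine Filter.liminf_le_of_le ?_ fun b hb => ?_
    · isBoundedDefault
    · obtain ⟨n, hn⟩ := hb.exists
      exact hn.trans (hW.lintegral_exp_abs_sup'_le p (hτ n) n)
  have hmeas : Measurable fun ω => Real.exp (p * ‖W ω‖) :=
    ((measurable_norm_path hT.le hW.measurable).const_mul p).exp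
  refine ⟨hmeas.aestronglyMeasurable, ?_⟩
  rw [hasFiniteIntegral_iff_ofReal (ae_of_all _ fun ω => (Real.exp_pos _).le)]
  exact hbound.trans_lt (by finiteness)

end IsWiener

/-! ### The driftless solution and (S.2) -/

lemma hypS2 {Ω : Type*} {mΩ : MeasurableSpace Ω} {P : Measure Ω} [IsProbabilityMeasure P]
    {m : Model} {𝓕 : Filtration (Time m.T) mΩ} {W : Ω → Path m.T} (hW : IsWiener 𝓕 P W)
    {ξ : Ω → ℝ} (hξ : ∀ t : Time m.T, (t : ℝ) = 0 → Measurable[𝓕 t] ξ)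
    (hexp : ∀ p : ℝ, 0 < p → Integrable (fun x : ℝ => Real.exp (p * |x|)) (P.map ξ)) :
    HypS2 m 𝓕 P ξ W where
  solution := by
    have hT := m.T_pos
    have hσ := m.σ_pos
    have hc := m.c₁_pos
    let z : Time m.T := ⟨0, le_rfl, hT.le⟩
    have hξm : Measurable ξ := (hξ z rfl).mono (𝓕.le z) le_rfl
    let X : Ω → Path m.T := fun ω => ContinuousMap.const _ (ξ ω) + m.σ • W ω
    have hX : ∀ ω t, X ω t = ξ ω + m.σ * W ω t := fun ω t => rfl
    have hXm : ∀ t, Measurable[𝓕 t] fun ω => X ω t := fun t =>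
      ((hξ z rfl).mono (𝓕.mono t.2.1) le_rfl).add ((hW.adapted t).const_mul _)
    refine ⟨X, ⟨hXm, fun t => ?_, fun t ht => ?_, ae_of_all _ fun ω t => hX ω t⟩, ?_⟩
    · have hle := le_eventuallyMeasurableSpace (m := MeasurableSpace.comap ξ inferInstance ⊔
        ⨆ s : Set.Iic t, MeasurableSpace.comap (fun ω => W ω s) inferInstance) (l := ae P)
      have h1 : Measurable[augmentedHistory P ξ W t] ξ :=
        Measurable.of_comap_le (le_sup_left.trans hle)
      have h2 : Measurable[augmentedHistory P ξ W t] fun ω => W ω t :=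
        Measurable.of_comap_le ((le_trans (le_iSup (fun s : Set.Iic t =>
          MeasurableSpace.comap (fun ω => W ω s) inferInstance) ⟨t, Set.self_mem_Iic⟩)
            le_sup_right).trans hle)
      exact h1.add (h2.const_mul _)
    · filter_upwards [hW.zero t ht] with ω h
      rw [hX, h, mul_zero, add_zero]
    -- The exponent `4 c₁` arises from `2 c₁` in `ψ²`, doubled by `a b ≤ a² + b²`.
    · have hξi : Integrable (fun ω => Real.exp (4 * m.c₁ * |ξ ω|)) P :=
        (hexp (4 * m.c₁) (by positivity)).comp_measurable hξm
      have hWi : Integrable (fun ω => Real.exp (4 * m.c₁ * m.σ * ‖W ω‖)) P :=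
        hW.integrable_exp_norm hT _
      have hmeas : Measurable fun ω => m.ψPath (X ω) ^ 2 :=
        (((measurable_norm_path hT.le fun t =>
          (hXm t).mono (𝓕.le t) le_rfl).const_mul _).exp).pow_const 2
      refine (hξi.add hWi).mono' hmeas.aestronglyMeasurable (ae_of_all _ fun ω => ?_)
      have hn : ‖X ω‖ ≤ |ξ ω| + m.σ * ‖W ω‖ := by
        refine (norm_add_le _ _).trans (add_le_add ?_ ?_)
        · exact (ContinuousMap.norm_le _ (abs_nonneg _)).2 fun _ => le_rfl
        · rw [norm_smul, Real.norm_of_nonneg hσ.le]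
      rw [Real.norm_of_nonneg (sq_nonneg _), Model.ψPath]
      have h1 : Real.exp (m.c₁ * ‖X ω‖) ^ 2
          ≤ Real.exp (2 * m.c₁ * |ξ ω|) * Real.exp (2 * m.c₁ * m.σ * ‖W ω‖) := by
        rw [← Real.exp_nat_mul, ← Real.exp_add]
        refine Real.exp_le_exp.2 ?_
        push_cast
        nlinarith
      have h2 : Real.exp (4 * m.c₁ * |ξ ω|) = Real.exp (2 * m.c₁ * |ξ ω|) ^ 2 := by
        rw [← Real.exp_nat_mul]
        push_cast
        ring_nf
      have h3 : Real.exp (4 * m.c₁ * m.σ * ‖W ω‖) = Real.exp (2 * m.c₁ * m.σ * ‖W ω‖) ^ 2 := by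
        rw [← Real.exp_nat_mul]
        push_cast
        ring_nf
      rw [Pi.add_apply, h2, h3]
      nlinarith [sq_nonneg (Real.exp (2 * m.c₁ * |ξ ω|) - Real.exp (2 * m.c₁ * m.σ * ‖W ω‖)),
        sq_nonneg (Real.exp (2 * m.c₁ * |ξ ω|)), sq_nonneg (Real.exp (2 * m.c₁ * m.σ * ‖W ω‖))]
  volatility := m.σ_pos
  drift_bounded := by
    refine ⟨|m.σ⁻¹| * m.controlBound, fun t x μ a => ?_⟩
    rw [abs_mul, Model.b]
    gcongr
    exact m.abs_le_controlBound a a.2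

end FeePool

end

theorem mainTheorem5 {Ω : Type*} {mΩ : MeasurableSpace Ω} (P : Measure Ω) [IsProbabilityMeasure P]
    (m : FeePool.Model) (𝓕 : Filtration (FeePool.Time m.T) mΩ)
    (W : Ω → FeePool.Path m.T) (hW : FeePool.IsWiener 𝓕 P W)
    (ξ : Ω → ℝ) (hξ : ∀ t : FeePool.Time m.T, (t : ℝ) = 0 → Measurable[𝓕 t] ξ)
    (lam₀ : Measure ℝ) (hlaw : P.map ξ = lam₀)
    (hexp : ∀ p : ℝ, 0 < p → Integrable (fun x : ℝ => Real.exp (p * |x|)) lam₀) :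
    FeePool.HypS1 m ∧
    FeePool.HypS2 m 𝓕 P ξ W ∧
    (∀ ε₀ : ℝ, 0 < ε₀ →
      FeePool.HypS3 m (m.flowsAbove ε₀) ∧ FeePool.HypS4 m (m.flowsAbove ε₀)) ∧
    (∀ M : ℝ, (∀ a ∈ m.A, |a| ≤ M) → M < m.x₀ / m.T →
      (∃ ε₀ : ℝ, 0 < ε₀ ∧ ∀ (q : m.Flow) (t : FeePool.Time m.T),
        ε₀ < FeePool.Model.reserve q t ∧ ε₀ < FeePool.Model.feeReserve q t) ∧
      FeePool.HypS3 m Set.univ ∧ FeePool.HypS4 m Set.univ) := by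
  subst hlaw
  refine ⟨FeePool.hypS1 m, FeePool.hypS2 hW hξ hexp,
    fun ε₀ hε₀ => ⟨FeePool.hypS3 m _, FeePool.hypS4 m hε₀⟩, fun M hM hlt => ?_⟩
  obtain ⟨ε₀, hε₀, h⟩ := FeePool.exists_reserve_bound m hM hlt
  have huniv : m.flowsAbove ε₀ = Set.univ := Set.eq_univ_of_forall fun q t => (h q t).1.le
  exact ⟨⟨ε₀, hε₀, h⟩, FeePool.hypS3 m _, huniv ▸ FeePool.hypS4 m hε₀⟩
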